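/- A \emph{Euclidean Jordan algebra} (EJA) is a real Hilbert space $E$, possibly infinite-dimensional, with a unital commutative (possibly non-associative) bilinear product $*$ satisfying $(a*b)*(a*a)=a*(b*(a*a))$ and $\langle a*b,c\rangle=\langle b,a*c\rangle$ for all $a,b,c\in E$. Write $a\ge 0$ if $a=b*b$ for some $b\in E$, and $a\le b$ if $b-a\ge 0$. An \emph{effect} is an $a$ with $0\le a\le 1$; an \emph{idempotent} is a $p$ with $p*p=p$; it is \emph{atomic} if $p\neq 0$ and there is no non-zero idempotent strictly below it; $p,q$ are \emph{orthogonal} if $p*q=0$. A linear map $f$ between EJAs is \emph{positive} if $a\ge0$ implies $f(a)\ge 0$, and \emph{subunital} if $f(1)\le 1$. For $a\in E$ let $L(a)b=a*b$ and $Q_a=2L(a)^2-L(a*a)$. For $a\ge 0$ the \emph{ceiling} is $\lceil a\rceil=\sum_i p_i$, where $a=\sum_i\lambda_i p_i$ is a finite decomposition with $\lambda_i>0$ and the $p_i$ pairwise orthogonal atomic idempotents. The \emph{image} $\operatorname{im} f$ of a positive linear map $f$ is the smallest effect $q$ with $f(q)=f(1)$. For a positive linear map $f\colon E\to F$ and idempotents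 $p\in E$, $q\in F$ put $f^\diamond(p)=\lceil f(p)\rceil$ and $f_\diamond(q)=\operatorname{im}(Q_q\circ f)$. Positive linear maps $f\colon E\to F$ and $g\colon F\to E$ are \emph{$\diamond$-adjoint} if $f^\diamond$ and $g_\diamond$ are well defined and equal as maps from the idempotents of $E$ to the idempotents of $F$. A positive linear map $f\colon E\to E$ is \emph{$\diamond$-self-adjoint} if it is $\diamond$-adjoint to itself, and \emph{$\diamond$-positive} if $f=g\circ g$ for some $\diamond$-self-adjoint $g$. \textbf{Proposition.} Let $E$ be a Euclidean Jordan algebra. \begin{enumerate} \item Every positive linear map $f\colon E\to E$ that is self-adjoint, i.e. $\langle f(a),b\rangle=\langle a,f(b)\rangle$ for all $a,b\in E$, is $\diamond$-self-adjoint. \item For every $a\in E$ the map $Q_a$ is positive and $\diamond$-self-adjoint. \item For every $a\ge 0$ in $E$ the map $Q_a$ is $\diamond$-positive. If moreover $Q_a$ is subunital, then $Q_a=g\circ g$ for some $\diamond$-self-adjoint $g$ that is itself subunital. \end{enumerate} -/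

import Mathlib

/-- A Euclidean Jordan algebra, possibly infinite-dimensional: a real Hilbert space carrying a
unital commutative (not necessarily associative) bilinear product that satisfies the Jordan
identity and whose multiplication operators are symmetric for the inner product. -/
class EuclideanJordanAlgebra (E : Type*) extends
    NonAssocCommRing E, NormedAddCommGroup E, InnerProductSpace ℝ E, CompleteSpace E where
  /-- the product is compatible with real scalars (additivity is part of the ring structure) -/
  smul_mul' : ∀ (r : ℝ) (a b : E), (r • a) * b = r • (a * b)
  /-- the Jordan identity -/
  jordan : ∀ a b : E, (a * b) * (a * a) = a * (b * (a * a))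
  /-- multiplication by a fixed element is symmetric -/
  inner_mul : ∀ a b c : E, Inner.inner ℝ (a * b) c = Inner.inner ℝ b (a * c)

namespace EuclideanJordanAlgebra

instance instIsScalarTower {E : Type*} [EuclideanJordanAlgebra E] : IsScalarTower ℝ E E :=
  ⟨fun r a b => smul_mul' r a b⟩

instance instSMulCommClass {E : Type*} [EuclideanJordanAlgebra E] : SMulCommClass ℝ E E :=
  ⟨fun r a b => by
    show r • (a * b) = a * (r • b)
    rw [mul_comm a b, mul_comm a (r • b), smul_mul']⟩

instance instIsCommJordan {E : Type*} [EuclideanJordanAlgebra E] : IsCommJordan E :=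
  ⟨jordan⟩

section Order

variable {E : Type*} [EuclideanJordanAlgebra E]

/-- An element is positive when it is a square. -/
def IsPos (a : E) : Prop := ∃ b : E, a = b * b

/-- The order `a ≤ b` of a Euclidean Jordan algebra: the difference `b - a` is positive. -/
def Le (a b : E) : Prop := IsPos (b - a)

/-- An effect is an element `a` with `0 ≤ a ≤ 1`. -/
def IsEffect (a : E) : Prop := IsPos a ∧ Le a 1

/-- An atomic idempotent: a non-zero idempotent with no non-zero idempotent strictly below it. -/
def IsAtomicIdem (p : E) : Prop :=
  IsIdempotentElem p ∧ p ≠ 0 ∧ ∀ q : E, IsIdempotentElem q → q ≠ 0 → Le q p → q = p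

/-- `IsCeil a c` says that `c` is the ceiling `⌈a⌉` of the positive element `a`: for a
decomposition `a = ∑ i, l i • p i` with all `l i > 0` and pairwise orthogonal atomic idempotents
`p i`, one puts `⌈a⌉ = ∑ i, p i`. It does not depend on the decomposition (`IsCeil.unique`). -/
def IsCeil (a c : E) : Prop :=
  ∃ (n : ℕ) (l : Fin n → ℝ) (p : Fin n → E),
    (∀ i, 0 < l i) ∧ (∀ i, IsAtomicIdem (p i)) ∧ (∀ i j, i ≠ j → p i * p j = 0) ∧
      a = ∑ i, l i • p i ∧ c = ∑ i, p i

/-- The quadratic representation `Q_a = 2 L(a)² - L(a²)`, where `L(a)` is multiplication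
by `a`. -/
def Q (a : E) : E →ₗ[ℝ] E :=
  (2 : ℝ) • (LinearMap.mulLeft ℝ a ∘ₗ LinearMap.mulLeft ℝ a) - LinearMap.mulLeft ℝ (a * a)

theorem inner_self_eq (b : E) : inner ℝ (b * b) 1 = inner ℝ b b := by
  rw [inner_mul, mul_one]

theorem Le.antisymm {a b : E} (hab : Le a b) (hba : Le b a) : a = b := by
  obtain ⟨x, hx⟩ := hab
  obtain ⟨y, hy⟩ := hba
  have h : x * x = -(y * y) := by rw [← hx, ← hy]; abel
  have h1 : inner ℝ x x = -inner ℝ y y := by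
    rw [← inner_self_eq, ← inner_self_eq, h, inner_neg_left]
  have h2 : inner ℝ x x = 0 :=
    le_antisymm (by rw [h1]; linarith [real_inner_self_nonneg (x := y)]) real_inner_self_nonneg
  have h3 : x = 0 := inner_self_eq_zero.mp h2
  rw [h3, mul_zero] at hx
  exact (sub_eq_zero.mp hx).symm

theorem aeval_mulLeft_sum {n : ℕ} (l : Fin n → ℝ) (p : Fin n → E)
    (hp : ∀ i, IsIdempotentElem (p i)) (ho : ∀ i j, i ≠ j → p i * p j = 0) (j : Fin n)
    (R : Polynomial ℝ) :
    (Polynomial.aeval (LinearMap.mulLeft ℝ (∑ i, l i • p i)) R) (p j) = R.eval (l j) • p j := by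
  have h : LinearMap.mulLeft ℝ (∑ i, l i • p i) (p j) = l j • p j := by
    rw [LinearMap.mulLeft_apply, Finset.sum_mul, Finset.sum_eq_single j]
    · rw [smul_mul_assoc, (hp j).eq]
    · intro i _ hi
      rw [smul_mul_assoc, ho i j hi, smul_zero]
    · simp
  induction R using Polynomial.induction_on' with
  | add f g hf hg => rw [map_add, LinearMap.add_apply, hf, hg, Polynomial.eval_add, add_smul]
  | monomial n c =>
    have hn : ∀ n : ℕ, (LinearMap.mulLeft ℝ (∑ i, l i • p i) ^ n) (p j) = l j ^ n • p j := by
      intro n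
      induction n with
      | zero => simp
      | succ n ih => rw [pow_succ', Module.End.mul_apply, ih, map_smul, h, smul_smul, pow_succ]
    rw [Polynomial.aeval_monomial, Polynomial.eval_monomial, Module.End.mul_apply, hn,
      Module.algebraMap_end_apply, smul_smul]

theorem sum_eq_aeval_mulLeft {n : ℕ} (l : Fin n → ℝ) (p : Fin n → E) (hl : ∀ i, 0 < l i)
    (hp : ∀ i, IsIdempotentElem (p i)) (ho : ∀ i j, i ≠ j → p i * p j = 0)
    (R : Polynomial ℝ) (hR : ∀ i, R.eval (l i) = (l i)⁻¹) :
    ∑ i, p i = (Polynomial.aeval (LinearMap.mulLeft ℝ (∑ i, l i • p i)) R) (∑ i, l i • p i) := by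
  rw [map_sum]
  refine Finset.sum_congr rfl fun j _ => ?_
  rw [map_smul, aeval_mulLeft_sum l p hp ho, hR, smul_smul, mul_inv_cancel₀ (hl j).ne', one_smul]

/-- The ceiling is independent of the choice of the decomposition. -/
theorem IsCeil.unique {a c d : E} (hc : IsCeil a c) (hd : IsCeil a d) : c = d := by
  classical
  obtain ⟨n, l, p, hl, hp, ho, ha, rfl⟩ := hc
  obtain ⟨m, k, q, hk, hq, ho', ha', rfl⟩ := hd
  let S : Finset ℝ := Finset.univ.image l ∪ Finset.univ.image k
  let R : Polynomial ℝ := Lagrange.interpolate S id fun x => x⁻¹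
  have hR : ∀ x ∈ S, R.eval x = x⁻¹ := fun x hx =>
    Lagrange.eval_interpolate_at_node (v := id) (fun x => x⁻¹) (Set.injOn_id _) hx
  rw [sum_eq_aeval_mulLeft l p hl (fun i => (hp i).1) ho R fun i => hR _ (by simp [S]),
    sum_eq_aeval_mulLeft k q hk (fun i => (hq i).1) ho' R fun i => hR _ (by simp [S]),
    ← ha, ← ha']

end Order

section Maps

variable {E F : Type*} [EuclideanJordanAlgebra E] [EuclideanJordanAlgebra F]

/-- A linear map is positive when it maps positive elements to positive elements. -/
def IsPositiveMap (f : E →ₗ[ℝ] F) : Prop := ∀ a : E, IsPos a → IsPos (f a)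

/-- A map is subunital when `f 1 ≤ 1`. -/
def IsSubunital (f : E →ₗ[ℝ] F) : Prop := Le (f 1) 1

/-- `IsImage f q` says that `q` is the image of `f`: the smallest effect with `f q = f 1`. -/
def IsImage (f : E →ₗ[ℝ] F) (q : E) : Prop :=
  IsEffect q ∧ f q = f 1 ∧ ∀ r : E, IsEffect r → f r = f 1 → Le q r

theorem IsImage.unique {f : E →ₗ[ℝ] F} {q r : E} (hq : IsImage f q) (hr : IsImage f r) : q = r :=
  (hq.2.2 r hr.1 hr.2.1).antisymm (hr.2.2 q hq.1 hq.2.1)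

/-- The idempotents of `E`. -/
def Idem (E : Type*) [EuclideanJordanAlgebra E] : Type _ := {p : E // IsIdempotentElem p}

/-- `IsDiamondUpper f φ` says that `f^◇` is the map `φ`, that is `φ p = ⌈f p⌉` for every
idempotent `p`. -/
def IsDiamondUpper (f : E →ₗ[ℝ] F) (φ : Idem E → Idem F) : Prop :=
  ∀ p : Idem E, IsCeil (f p.1) (φ p).1

/-- `IsDiamondLower f ψ` says that `f_◇` is the map `ψ`, that is `ψ q = im (Q_q ∘ f)` for every
idempotent `q`. -/
def IsDiamondLower (f : E →ₗ[ℝ] F) (ψ : Idem F → Idem E) : Prop :=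
  ∀ q : Idem F, IsImage (Q q.1 ∘ₗ f) (ψ q).1

theorem IsDiamondUpper.unique {f : E →ₗ[ℝ] F} {φ χ : Idem E → Idem F}
    (hφ : IsDiamondUpper f φ) (hχ : IsDiamondUpper f χ) : φ = χ :=
  funext fun p => Subtype.ext ((hφ p).unique (hχ p))

theorem IsDiamondLower.unique {f : E →ₗ[ℝ] F} {φ χ : Idem F → Idem E}
    (hφ : IsDiamondLower f φ) (hχ : IsDiamondLower f χ) : φ = χ :=
  funext fun p => Subtype.ext ((hφ p).unique (hχ p))

/-- The positive map `f : E → F` is ◇-adjoint to the positive map `g : F → E` when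
`f^◇ = g_◇`: both maps are defined, and they are the same map from the idempotents of `E` to
those of `F`. -/
def IsDiamondAdjoint (f : E →ₗ[ℝ] F) (g : F →ₗ[ℝ] E) : Prop :=
  IsPositiveMap f ∧ IsPositiveMap g ∧
    ∃ φ : Idem E → Idem F, IsDiamondUpper f φ ∧ IsDiamondLower g φ

/-- A positive map is ◇-self-adjoint when it is ◇-adjoint to itself. -/
def IsDiamondSelfAdjoint (f : E →ₗ[ℝ] E) : Prop := IsDiamondAdjoint f f

/-- A map is ◇-positive when it is the square of a ◇-self-adjoint positive map. -/
def IsDiamondPositive (f : E →ₗ[ℝ] E) : Prop :=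
  ∃ g : E →ₗ[ℝ] E, IsDiamondSelfAdjoint g ∧ f = g ∘ₗ g

/-- ◇-positivity within the positive subunital maps: `f` is subunital, and it is the square of a
◇-self-adjoint positive subunital map. -/
def IsSubunitalDiamondPositive (f : E →ₗ[ℝ] E) : Prop :=
  IsSubunital f ∧ ∃ g : E →ₗ[ℝ] E, IsSubunital g ∧ IsDiamondSelfAdjoint g ∧ f = g ∘ₗ g

end Maps

end EuclideanJordanAlgebra

/-! The cone of squares is self-dual and every element is a finite combination of orthogonal atoms.
For a symmetric positive `f` and an idempotent `p`, an effect `r` satisfies `Q p (f r) = Q p (f 1)`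
iff the positive element `Q p (f (1 - r))` pairs to zero with `1`, i.e. iff `⟨1 - r, f p⟩ = 0`. A
positive element is orthogonal to `f p` exactly when it is orthogonal to its ceiling `c`, and `⟨1 -
r, c⟩ = 0` forces `c ≤ r`. So `c` is the image (`IsCeil.isImage`).

`Q a` is symmetric; its positivity is checked on atoms `p`, where `(Q a p)² = Q a (Q p a²)` is a
non-negative multiple of `Q a p`. If `a = b²`, then `Q a = Q b ∘ Q b`, which gives ◇-positivity.

No finite dimension is assumed, so the spectral theorem has to be proved. Idempotents arise as
limits of normalised powers. The product is automatically bounded, hence non-zero idempotents have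
norm bounded below, and splitting `1` into orthogonal idempotents must stop. -/

namespace EuclideanJordanAlgebra

/-! ### Jordan identities, Peirce relations and power associativity -/

section Algebra

variable {E : Type*} [EuclideanJordanAlgebra E]

/-- The linearised Jordan identity. -/
theorem jordan_linearized (x y z w : E) :
    (x * w) * (y * z) + (y * w) * (z * x) + (z * w) * (x * y) -
      (x * (w * (y * z)) + y * (w * (z * x)) + z * (w * (x * y))) = 0 := by
  have h := two_nsmul_lie_lmul_lmul_add_add_eq_zero x y z
  have h2 : (2 : ℕ) • ((x * ((y * z) * w) - (y * z) * (x * w)) +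
      (y * ((z * x) * w) - (z * x) * (y * w)) + (z * ((x * y) * w) - (x * y) * (z * w))) = 0 :=
    DFunLike.congr_fun h w
  have h3 : (2 : ℝ) • ((x * w) * (y * z) + (y * w) * (z * x) + (z * w) * (x * y) -
      (x * (w * (y * z)) + y * (w * (z * x)) + z * (w * (x * y)))) = 0 := by
    simp only [mul_comm] at h2 ⊢
    linear_combination (norm := module) -h2
  exact (smul_eq_zero.mp h3).resolve_left two_ne_zero

theorem Q_apply (a b : E) : Q a b = (2 : ℝ) • (a * (a * b)) - (a * a) * b := rfl

/-- This is the fundamental formula `Q (Q a b) = Q a ∘ Q b ∘ Q a` evaluated at `1`. The proof is an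
explicit certificate: instances of the linearised Jordan identity, some multiplied by further
elements. -/
theorem Q_apply_mul_Q_apply (a b : E) : Q a b * Q a b = Q a (Q b (a * a)) := by
  have h1 := jordan_linearized a b (b * (a * a)) a
  have h2 := congrArg (a * ·) (jordan_linearized a a b (a * b))
  have h3 := jordan_linearized a a (b * (a * b)) a
  have h4 := congrArg (a * ·) (congrArg (a * ·) (jordan_linearized a a b b))
  have h5 := jordan_linearized a a a (b * (a * b))
  have h6 := jordan_linearized a a (a * b) (a * b)
  have h7 := congrArg (b * ·) (congrArg (a * ·) (jordan_linearized a a a b))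
  have h8 := jordan_linearized b (a * a) (a * b) a
  have h9 := congrArg ((a * b) * ·) (jordan_linearized a a a b)
  have h10 := congrArg (a * ·) (congrArg (b * ·) (jordan_linearized a a a b))
  have h11 := jordan_linearized a a (b * (a * a)) b
  have h12 := congrArg ((a * a) * ·) (jordan_linearized a a b b)
  simp only [Q_apply, mul_add, mul_sub, sub_mul, mul_smul_comm, smul_mul_assoc,
    mul_zero] at *
  simp only [mul_comm] at *
  linear_combination (norm := module) (2 : ℝ) • h1 + (2 : ℝ) • h2 - (2 : ℝ) • h3 + (2 : ℝ) • h4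
    + (2 / 3 : ℝ) • h5 + (2 : ℝ) • h6 - (2 / 3 : ℝ) • h7 - (2 : ℝ) • h8 + (4 / 3 : ℝ) • h9
    + (2 / 3 : ℝ) • h10 - h11 - h12

/-- The linearised identity solved for multiplication by a triple product, which it reduces to
multiplication by shorter products. -/
theorem mul_mul_mul_eq (w x y z : E) :
    (w * (x * y)) * z = (x * w) * (y * z) + (y * w) * (x * z) + (x * y) * (w * z)
      - x * (w * (y * z)) - y * (w * (x * z)) := by
  have h := jordan_linearized x y z w
  simp only [mul_comm] at h ⊢
  linear_combination (norm := module) -h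

theorem Q_comp_Q_self (b : E) : Q b ∘ₗ Q b = Q (b * b) := by
  refine LinearMap.ext fun x => ?_
  have h1 := jordan_linearized b b b (b * x)
  have h2 := congrArg (b * ·) (jordan_linearized b b b x)
  have h3 := jordan_linearized b b (b * x) b
  have h4 := jordan_linearized b b x (b * b)
  simp only [LinearMap.comp_apply, Q_apply, mul_add, mul_sub, mul_smul_comm, mul_zero] at *
  simp only [mul_comm] at *
  linear_combination (norm := module) (4 / 3 : ℝ) • h1 + (2 / 3 : ℝ) • h2 - (2 : ℝ) • h3 - h4

theorem Q_isSymmetric (a : E) : (Q a).IsSymmetric := by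
  intro x y
  simp only [Q_apply, inner_sub_left, inner_sub_right, inner_smul_left, inner_smul_right,
    inner_mul, conj_trivial]

theorem Q_one_right (a : E) : Q a 1 = a * a := by
  rw [Q_apply, mul_one, mul_one]; module

/-- Peirce polynomial: `L = L(p)` satisfies `2L³ - 3L² + L = 0`, so its only possible eigenvalues
are 0, 1/2 and 1. -/
theorem idem_mul_mul_mul {p : E} (hp : p * p = p) (x : E) :
    p * (p * (p * x)) = (3 / 2 : ℝ) • (p * (p * x)) - (1 / 2 : ℝ) • (p * x) := by
  have h := mul_mul_mul_eq p p p x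
  rw [hp, hp] at h
  linear_combination (norm := module) (1 / 2 : ℝ) • h

theorem norm_sq_idem_mul_le {p : E} (hp : p * p = p) (b : E) :
    ‖p * b‖ ^ 2 ≤ inner ℝ (p * b) b := by
  have h3 := idem_mul_mul_mul hp b
  -- By the Peirce polynomial this square equals `(⟨p * b, b⟩ - ‖p * b‖²) / 4`.
  have h0 : 0 ≤ ‖p * b - p * (p * b)‖ ^ 2 := sq_nonneg _
  have e1 : inner ℝ (p * b) (p * b) = inner ℝ (p * (p * b)) b := by rw [inner_mul p (p * b) b]
  have e2 : inner ℝ (p * b) (p * (p * b)) =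
      3 / 2 * inner ℝ (p * (p * b)) b - 1 / 2 * inner ℝ (p * b) b := by
    rw [← inner_mul p (p * b) (p * b), ← inner_mul, h3, inner_sub_left, inner_smul_left,
      inner_smul_left]
    rfl
  have e3 : inner ℝ (p * (p * b)) (p * (p * b)) =
      3 / 2 * inner ℝ (p * b) (p * (p * b)) - 1 / 2 * inner ℝ (p * b) (p * b) := by
    rw [inner_mul p (p * b) (p * (p * b)), h3, inner_sub_right, inner_smul_right, inner_smul_right]
  rw [norm_sub_sq_real, ← real_inner_self_eq_norm_sq, ← real_inner_self_eq_norm_sq] at h0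
  rw [← real_inner_self_eq_norm_sq]
  linarith

theorem inner_idem_mul_nonneg {p : E} (hp : p * p = p) (b : E) : 0 ≤ inner ℝ (p * b) b :=
  (sq_nonneg _).trans (norm_sq_idem_mul_le hp b)

theorem idem_mul_eq_zero_of_inner {p : E} (hp : p * p = p) {b : E}
    (h : inner ℝ (p * b) b = 0) : p * b = 0 := by
  have := norm_sq_idem_mul_le hp b
  rw [h] at this
  exact norm_eq_zero.mp (pow_eq_zero_iff two_ne_zero |>.mp (le_antisymm this (sq_nonneg _)))

/-- Elements of the Peirce 0-space operator-commute with `p`; the next lemma does the same for the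
1-space. Together they make the two spaces annihilate each other. -/
theorem mul_left_comm_of_mul_eq_zero {p : E} (hp : p * p = p) {x : E} (hx : p * x = 0) (y : E) :
    p * (x * y) = x * (p * y) := by
  have h := jordan_linearized p p x y
  simp only [mul_comm x p, hx, hp, mul_zero] at h
  simp only [mul_comm] at h ⊢
  linear_combination (norm := module) h

theorem mul_left_comm_of_mul_eq_self {p : E} (hp : p * p = p) {x : E} (hx : p * x = x) (y : E) :
    p * (x * y) = x * (p * y) := by
  have h := jordan_linearized p p x y
  simp only [mul_comm x p, hx, hp] at h
  simp only [mul_comm] at h ⊢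
  linear_combination (norm := module) -h

theorem mul_eq_zero_of_peirce {p x y : E} (hp : p * p = p) (hx : p * x = x) (hy : p * y = 0) :
    x * y = 0 := by
  have h1 := mul_left_comm_of_mul_eq_zero hp hy x
  have h2 := mul_left_comm_of_mul_eq_self hp hx y
  rw [hy, mul_zero] at h2
  rw [mul_comm y x, h2, hx, mul_comm] at h1
  exact h1.symm

theorem isIdempotentElem_one_sub {p : E} (hp : p * p = p) : (1 - p) * (1 - p) = 1 - p := by
  rw [mul_sub, sub_mul, sub_mul, mul_one, one_mul, mul_one, hp]; abel

theorem idem_mul_Q {p : E} (hp : p * p = p) (x : E) : p * Q p x = Q p x := by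
  rw [Q_apply, mul_sub, mul_smul_comm, idem_mul_mul_mul hp, hp]
  module

/-- The powers `a ^ (n + 1)` of an element. -/
def powSucc (a : E) (n : ℕ) : E := (a * ·)^[n] a

@[simp] theorem powSucc_zero (a : E) : powSucc a 0 = a := rfl

theorem powSucc_succ (a : E) (n : ℕ) : powSucc a (n + 1) = a * powSucc a n :=
  Function.iterate_succ_apply' _ _ _

theorem powSucc_mul_left_comm (a : E) (n : ℕ) (z : E) :
    a * (powSucc a n * z) = powSucc a n * (a * z) := by
  -- Multiplication by `a ^ (n + 3)` is a polynomial in multiplication by `a`, `a²` and the two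
  -- preceding powers, hence a two-step induction; the case of `a²` is the Jordan identity.
  induction n using Nat.twoStepInduction generalizing z with
  | zero => rfl
  | one =>
    have h := commute_lmul_lmul_sq a
    exact DFunLike.congr_fun h z
  | more n ih1 ih2 =>
    have key : ∀ z, powSucc a (n + 2) * z = (a * a) * (powSucc a n * z) +
        powSucc a (n + 1) * (a * z) + powSucc a (n + 1) * (a * z)
        - a * (a * (powSucc a n * z)) - powSucc a n * (a * (a * z)) := by
      intro z
      have h := mul_mul_mul_eq a a (powSucc a n) z
      rw [mul_comm (powSucc a n) a] at h
      rw [powSucc_succ, powSucc_succ, h]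
    have hsq : ∀ z, a * ((a * a) * z) = (a * a) * (a * z) := fun z =>
      DFunLike.congr_fun (commute_lmul_lmul_sq a) z
    rw [key, key]
    simp only [mul_add, mul_sub, hsq, ih1, ih2]

theorem powSucc_mul_powSucc (a : E) (m n : ℕ) :
    powSucc a m * powSucc a n = powSucc a (m + n + 1) := by
  induction n with
  | zero => rw [powSucc_zero, mul_comm, ← powSucc_succ, add_zero]
  | succ n ih => rw [powSucc_succ a n, ← powSucc_mul_left_comm, ih, ← powSucc_succ]; rfl

end Algebra

/-! ### Boundedness of the product and idempotents as limits of powers -/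

section Hilbert

open Filter Topology

/-- `⟨U^(2m) y, U^(2n) y⟩ = ‖U^(m+n) y‖²` depends only on `m + n` and decreases to a limit, so the
even powers form a Cauchy sequence. -/
theorem exists_tendsto_pow_two_mul {H : Type*} [NormedAddCommGroup H] [InnerProductSpace ℝ H]
    [CompleteSpace H] {U : H →L[ℝ] H} (hU : IsSelfAdjoint U) (h1 : ‖U‖ ≤ 1) (y : H) :
    ∃ v, Tendsto (fun n : ℕ => (U ^ (2 * n)) y) atTop (𝓝 v) := by
  have hs : ∀ (m : ℕ) (u v : H), inner ℝ ((U ^ m) u) v = inner ℝ u ((U ^ m) v) := fun m =>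
    ContinuousLinearMap.isSelfAdjoint_iff_isSymmetric.mp (hU.pow m)
  have hin : ∀ m n : ℕ, inner ℝ ((U ^ (2 * m)) y) ((U ^ (2 * n)) y) = ‖(U ^ (m + n)) y‖ ^ 2 := by
    intro m n
    rw [← real_inner_self_eq_norm_sq, hs, hs, ← mul_apply_eq_comp,
      ← mul_apply_eq_comp, ← pow_add, ← pow_add]
    congr 3; ring
  have hanti : Antitone fun n => ‖(U ^ n) y‖ ^ 2 := by
    refine antitone_nat_of_succ_le fun n => ?_
    have := U.le_of_opNorm_le h1 ((U ^ n) y)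
    rw [one_mul, ← mul_apply_eq_comp, ← pow_succ'] at this
    gcongr
  obtain ⟨c, hc⟩ : ∃ c, Tendsto (fun n => ‖(U ^ n) y‖ ^ 2) atTop (𝓝 c) :=
    ⟨_, tendsto_atTop_ciInf hanti ⟨0, by rintro _ ⟨n, rfl⟩; positivity⟩⟩
  refine cauchySeq_tendsto_of_complete (Metric.cauchySeq_iff'.mpr fun ε hε => ?_)
  obtain ⟨N, hN⟩ := Metric.tendsto_atTop.mp hc (ε ^ 2 / 4) (by positivity)
  refine ⟨N, fun n hn => ?_⟩
  rw [dist_eq_norm]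
  refine lt_of_pow_lt_pow_left₀ 2 hε.le ?_
  have hn2 : ∀ m : ℕ, ‖(U ^ (2 * m)) y‖ ^ 2 = ‖(U ^ (m + m)) y‖ ^ 2 := fun m => by rw [two_mul]
  rw [norm_sub_sq_real, hin, hn2, hn2]
  have a1 := abs_lt.mp (hN (n + n) (by omega))
  have a2 := abs_lt.mp (hN (n + N) (by omega))
  have a3 := abs_lt.mp (hN (N + N) (by omega))
  linarith [a1.1, a1.2, a2.1, a2.2, a3.1, a3.2]

theorem norm_pow_two_pow_eq_one {H : Type*} [NormedAddCommGroup H] [InnerProductSpace ℝ H]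
    [CompleteSpace H] {U : H →L[ℝ] H} (hU : IsSelfAdjoint U) (h1 : ‖U‖ = 1) (k : ℕ) :
    ‖U ^ (2 ^ k)‖ = 1 := by
  induction k with
  | zero => rw [pow_zero, pow_one, h1]
  | succ k ih =>
    have h2 := ContinuousLinearMap.norm_adjoint_comp_self (U ^ (2 ^ k))
    rw [ContinuousLinearMap.isSelfAdjoint_iff'.mp (hU.pow _), ih, mul_one] at h2
    rw [pow_succ 2 k, pow_mul, sq]
    exact h2

theorem exists_normalized {H : Type*} [NormedAddCommGroup H] [InnerProductSpace ℝ H]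
    [CompleteSpace H] {T : H →L[ℝ] H} (hT : IsSelfAdjoint T) (h0 : T ≠ 0) :
    ∃ (M : ℝ) (U : H →L[ℝ] H), 0 < M ∧ IsSelfAdjoint U ∧ ‖U‖ = 1 ∧
      ∀ n s, (T ^ n) s = M ^ n • (U ^ n) s := by
  have hM : 0 < ‖T‖ := norm_pos_iff.mpr h0
  refine ⟨‖T‖, ‖T‖⁻¹ • T, hM, (IsSelfAdjoint.all _).smul hT, ?_, fun n s => ?_⟩
  · rw [norm_smul, norm_inv, norm_norm, inv_mul_cancel₀ hM.ne']
  · rw [smul_pow, smul_apply, smul_smul, ← mul_pow, mul_inv_cancel₀ hM.ne',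
      one_pow, one_smul]

variable {E : Type*} [EuclideanJordanAlgebra E]

theorem isSymmetric_mulLeft (a : E) : (LinearMap.mulLeft ℝ a).IsSymmetric := fun x y => by
  simp only [LinearMap.mulLeft_apply, inner_mul]

/-- Each multiplication operator is symmetric and everywhere defined, hence continuous; uniform
boundedness over the unit ball then gives a joint bound. -/
theorem exists_norm_mul_le (E : Type*) [EuclideanJordanAlgebra E] :
    ∃ C : ℝ, 0 < C ∧ ∀ a b : E, ‖a * b‖ ≤ C * ‖a‖ * ‖b‖ := by
  let L : E → E →L[ℝ] E := fun a => ⟨LinearMap.mulLeft ℝ a, (isSymmetric_mulLeft a).continuous⟩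
  have hL : ∀ a b, L a b = a * b := fun a b => rfl
  obtain ⟨C, hC⟩ := banach_steinhaus (g := fun a : Metric.closedBall (0 : E) 1 => L a)
    fun b => ⟨‖L b‖, fun a => by
      rw [hL, mul_comm, ← hL]
      have ha : ‖(a : E)‖ ≤ 1 := mem_closedBall_zero_iff.mp a.2
      exact ((L b).le_of_opNorm_le_of_le le_rfl ha).trans_eq (mul_one _)⟩
  refine ⟨max C 1, by positivity, fun a b => ?_⟩
  rcases eq_or_ne a 0 with rfl | ha
  · simp
  have hn : 0 < ‖a‖ := norm_pos_iff.mpr ha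
  have h1 := hC ⟨‖a‖⁻¹ • a, by simp [norm_smul, hn.ne']⟩
  have h2 := (L (‖a‖⁻¹ • a)).le_of_opNorm_le (h1.trans (le_max_left C 1)) b
  rw [hL, smul_mul_assoc, norm_smul, norm_inv, norm_norm, inv_mul_le_iff₀ hn] at h2
  linarith

theorem continuous_mul_left (a : E) : Continuous fun b : E => a * b :=
  (isSymmetric_mulLeft a).continuous

theorem tendsto_mul {u v : ℕ → E} {a b : E} (hu : Tendsto u atTop (𝓝 a))
    (hv : Tendsto v atTop (𝓝 b)) : Tendsto (fun n => u n * v n) atTop (𝓝 (a * b)) := by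
  obtain ⟨C, hC, h⟩ := exists_norm_mul_le E
  have hb : IsBoundedBilinearMap ℝ fun p : E × E => p.1 * p.2 :=
    { add_left := fun _ _ _ => add_mul _ _ _
      smul_left := fun _ _ _ => smul_mul_assoc _ _ _
      add_right := fun _ _ _ => mul_add _ _ _
      smul_right := fun _ _ _ => mul_smul_comm _ _ _
      bound := ⟨C, hC, h⟩ }
  exact (hb.continuous.tendsto (a, b)).comp (hu.prodMk_nhds hv)

/-- The closed non-unital subalgebra generated by an element, as a subspace. -/
def closedSpan (x : E) : Submodule ℝ E :=
  (Submodule.span ℝ (Set.range (powSucc x))).topologicalClosure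

theorem powSucc_mem_closedSpan (x : E) (n : ℕ) : powSucc x n ∈ closedSpan x :=
  Submodule.le_topologicalClosure _ (Submodule.subset_span ⟨n, rfl⟩)

theorem closedSpan_le {x : E} {S : Submodule ℝ E} (hS : IsClosed (S : Set E))
    (h : ∀ n, powSucc x n ∈ S) : closedSpan x ≤ S :=
  Submodule.topologicalClosure_minimal _
    (Submodule.span_le.mpr (by rintro _ ⟨n, rfl⟩; exact h n)) hS

theorem isClosed_closedSpan (x : E) : IsClosed (closedSpan x : Set E) :=
  Submodule.isClosed_topologicalClosure _

theorem mul_mem_closedSpan {x s : E} (hs : s ∈ closedSpan x) : x * s ∈ closedSpan x :=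
  closedSpan_le (S := (closedSpan x).comap (LinearMap.mulLeft ℝ x))
    ((isClosed_closedSpan x).preimage (continuous_mul_left x))
    (fun n => by
      rw [Submodule.mem_comap, LinearMap.mulLeft_apply, ← powSucc_succ]
      exact powSucc_mem_closedSpan x _) hs

/-- Multiplication by `x` on the closed subalgebra generated by `x`. -/
def mulClosedSpan (x : E) : closedSpan x →L[ℝ] closedSpan x :=
  ⟨(LinearMap.mulLeft ℝ x).restrict fun _ h => mul_mem_closedSpan h,
    ((continuous_mul_left x).comp continuous_subtype_val).subtype_mk _⟩

instance (x : E) : CompleteSpace (closedSpan x) := (isClosed_closedSpan x).completeSpace_coe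

@[simp] theorem coe_mulClosedSpan (x : E) (s : closedSpan x) :
    (mulClosedSpan x s : E) = x * s := rfl

theorem isSelfAdjoint_mulClosedSpan (x : E) : IsSelfAdjoint (mulClosedSpan x) :=
  ContinuousLinearMap.isSelfAdjoint_iff_isSymmetric.mpr fun s t =>
    isSymmetric_mulLeft x (s : E) (t : E)

theorem mulClosedSpan_pow_powSucc (x : E) (m n : ℕ) :
    (((mulClosedSpan x) ^ m) ⟨powSucc x n, powSucc_mem_closedSpan x n⟩ : E)
      = powSucc x (m + n) := by
  induction m with
  | zero => simp
  | succ m ih =>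
    rw [pow_succ', mul_apply_eq_comp, coe_mulClosedSpan, ih, ← powSucc_succ]
    congr 1; ring

/-- Power associativity, extended from powers of `x` to their closed span by linearity and
continuity. -/
theorem powSucc_mul_coe (x : E) (n : ℕ) (s : closedSpan x) :
    powSucc x n * (s : E) = ((mulClosedSpan x) ^ (n + 1)) s := by
  induction n generalizing s with
  | zero => simp
  | succ n ih =>
    obtain ⟨s, hs⟩ := s
    have h : closedSpan x ≤ LinearMap.ker (LinearMap.mulLeft ℝ (powSucc x (n + 1)) -
        LinearMap.mulLeft ℝ x ∘ₗ LinearMap.mulLeft ℝ (powSucc x n)) := by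
      refine closedSpan_le ?_ fun m => ?_
      · exact isClosed_singleton.preimage (f := fun s : E => powSucc x (n + 1) * s -
          x * (powSucc x n * s)) ((continuous_mul_left _).sub
            ((continuous_mul_left x).comp (continuous_mul_left _)))
      · simp only [LinearMap.mem_ker, LinearMap.sub_apply, LinearMap.comp_apply,
          LinearMap.mulLeft_apply, powSucc_mul_powSucc, ← powSucc_succ]
        rw [sub_eq_zero]; congr 1; ring
    have h2 := sub_eq_zero.mp (h hs)
    simp only [LinearMap.comp_apply, LinearMap.mulLeft_apply] at h2
    rw [h2, ih ⟨s, hs⟩, pow_succ' _ (n + 1), mul_apply_eq_comp, coe_mulClosedSpan]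

/-- With `M` the norm of multiplication by `x` on `closedSpan x`, the elements `(x / M) ^ (2n + 2)`
converge to an idempotent `v`, on which `x` acts with square `M²`. -/
theorem exists_idem_limit {x : E} (hx : x ≠ 0) :
    ∃ (M : ℝ) (v : E), 0 < M ∧ v ≠ 0 ∧ v ∈ closedSpan x ∧ v * v = v ∧ v * (x * v) = x * v ∧
      x * (x * v) = M ^ 2 • v ∧ (x * v) * (x * v) = M ^ 2 • v := by
  obtain ⟨M, U, hM, hUs, hUn, hTU⟩ := exists_normalized (isSelfAdjoint_mulClosedSpan x) fun h0 =>
    hx <| by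
      have h1 := congrArg Subtype.val (DFunLike.congr_fun h0 ⟨x, powSucc_mem_closedSpan x 0⟩)
      have h2 : x * x = 0 := h1
      have h3 := inner_self_eq x
      rw [h2, inner_zero_left] at h3
      exact inner_self_eq_zero.mp h3.symm
  have hxU : ∀ s : closedSpan x, x * (s : E) = M • (U s : E) := fun s => by
    have := hTU 1 s
    rw [pow_one, pow_one, pow_one] at this
    rw [← coe_mulClosedSpan, this]; rfl
  -- This is `(x / M)²`, so that multiplication by `U ^ n y` acts on the span as `U ^ (n + 2)`.
  let y : closedSpan x := (M⁻¹ ^ 2) • ⟨powSucc x 1, powSucc_mem_closedSpan x 1⟩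
  obtain ⟨v, hv⟩ := exists_tendsto_pow_two_mul hUs hUn.le y
  have hz : ∀ n, ((U ^ n) y : E) = M⁻¹ ^ (n + 2) • powSucc x (n + 1) := by
    intro n
    have h1 : ((U ^ n) y) = M⁻¹ ^ n • ((mulClosedSpan x) ^ n) y := by
      rw [hTU, smul_smul, ← mul_pow, inv_mul_cancel₀ hM.ne', one_pow, one_smul]
    rw [h1]
    simp only [y, map_smul, Submodule.coe_smul, mulClosedSpan_pow_powSucc, smul_smul]
    rw [← pow_add]
  have hzs : ∀ n (s : closedSpan x), ((U ^ n) y : E) * s = ((U ^ (n + 2)) s : E) := by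
    intro n s
    rw [hz, smul_mul_assoc, powSucc_mul_coe, hTU, Submodule.coe_smul, smul_smul, ← mul_pow,
      inv_mul_cancel₀ hM.ne', one_pow, one_smul]
  have hve : Tendsto (fun n => ((U ^ (2 * n)) y : E)) atTop (𝓝 (v : E)) :=
    (continuous_subtype_val.tendsto v).comp hv
  have hUv : U (U v) = v := by
    have h1 : Tendsto (fun n : ℕ => (U ^ (2 * (n + 1))) y) atTop (𝓝 v) :=
      hv.comp (tendsto_add_atTop_nat 1)
    have h2 : Tendsto (fun n : ℕ => U (U ((U ^ (2 * n)) y))) atTop (𝓝 (U (U v))) :=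
      ((U.continuous.comp U.continuous).tendsto v).comp hv
    refine tendsto_nhds_unique h2 (h1.congr fun n => ?_)
    rw [mul_add, mul_one, add_comm, pow_add, mul_apply_eq_comp, pow_two,
      mul_apply_eq_comp]
  have hmulv : ∀ s : closedSpan x, U (U s) = s → (v : E) * s = s := by
    intro s hs
    have hsn : ∀ n, (U ^ (2 * n)) s = s := by
      intro n
      induction n with
      | zero => simp
      | succ n ih => rw [mul_add, pow_add, mul_apply_eq_comp, mul_one, pow_two,
          mul_apply_eq_comp, hs, ih]
    refine tendsto_nhds_unique (tendsto_mul hve tendsto_const_nhds)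
      (tendsto_const_nhds.congr fun n => ?_)
    rw [hzs, show 2 * n + 2 = 2 * (n + 1) by ring, hsn]
  have hxx : x * (x * (v : E)) = M ^ 2 • (v : E) := by
    rw [hxU, mul_smul_comm, hxU, hUv, smul_smul, pow_two]
  refine ⟨M, v, hM, ?_, v.2, hmulv v hUv, ?_, hxx, ?_⟩
  -- For `v ≠ 0`: multiplication by `U ^ (2 * (2 ^ k - 1)) y` is `U ^ (2 ^ (k + 1))`, of norm 1 by
  -- the C*-identity, so these elements have norm at least `1 / C`, and so does their limit.
  · obtain ⟨C, hC, hCm⟩ := exists_norm_mul_le E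
    have hlow : ∀ k : ℕ, 1 ≤ C * ‖((U ^ (2 * (2 ^ k - 1))) y : E)‖ := by
      intro k
      have e : 2 * (2 ^ k - 1) + 2 = 2 ^ (k + 1) := by
        have := Nat.one_le_two_pow (n := k)
        rw [pow_succ]; omega
      have h1 : ‖U ^ (2 ^ (k + 1))‖ = 1 := norm_pow_two_pow_eq_one hUs hUn (k + 1)
      rw [← h1, ← e]
      refine ContinuousLinearMap.opNorm_le_bound _ (by positivity) fun s => ?_
      have := hCm ((U ^ (2 * (2 ^ k - 1))) y : E) s
      rw [hzs] at this
      exact this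
    have hlim : Tendsto (fun k : ℕ => C * ‖((U ^ (2 * (2 ^ k - 1))) y : E)‖) atTop
        (𝓝 (C * ‖(v : E)‖)) := by
      refine ((hve.comp (f := fun k => 2 ^ k - 1) ?_).norm).const_mul C
      refine tendsto_atTop_mono (fun k => ?_) tendsto_id
      have : k < 2 ^ k := Nat.lt_two_pow_self
      simp only [id]; omega
    have h1 := ge_of_tendsto' hlim hlow
    rintro h0
    rw [h0, norm_zero, mul_zero] at h1
    linarith
  · have := hmulv (U v) (by rw [hUv])
    rw [hxU, mul_smul_comm, this]
  · have hw : Tendsto (fun n => x * ((U ^ (2 * n)) y : E)) atTop (𝓝 (x * (v : E))) :=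
      tendsto_mul tendsto_const_nhds hve
    have h1 : Tendsto (fun n : ℕ => M ^ 2 • ((U ^ (2 * (2 * n + 2))) y : E)) atTop
        (𝓝 (M ^ 2 • (v : E))) := by
      refine (hve.comp (f := fun n => 2 * n + 2) ?_).const_smul _
      exact tendsto_atTop_mono (fun n => by simp only [id]; omega) tendsto_id
    refine tendsto_nhds_unique (tendsto_mul hw hw) (h1.congr fun n => ?_)
    rw [hz, hz, mul_smul_comm, smul_mul_smul_comm, ← powSucc_succ, powSucc_mul_powSucc, smul_smul]
    congr 1
    · rw [show 2 * (2 * n + 2) + 2 = 2 + ((2 * n + 2) + (2 * n + 2)) by ring, pow_add, ← mul_assoc,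
        ← mul_pow, mul_inv_cancel₀ hM.ne', one_pow, one_mul, pow_add]
    · congr 1; ring

/-- `u = (x * v) / M` satisfies `u² = v` and `v * u = u`, so `(v ± u) / 2` are idempotents with
eigenvalues `± M`. They sum to `v ≠ 0`, so one of them is non-zero. -/
theorem exists_eigen_idem {x : E} (hx : x ≠ 0) :
    ∃ (q : E) (l : ℝ), q * q = q ∧ q ≠ 0 ∧ l ≠ 0 ∧ x * q = l • q ∧ q ∈ closedSpan x := by
  obtain ⟨M, v, hM, hv0, hvS, hvv, hvx, hxx, hsq⟩ := exists_idem_limit hx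
  have main : ∀ l : ℝ, l ≠ 0 → l ^ 2 = M ^ 2 →
      ((1 / 2 : ℝ) • (v + l⁻¹ • (x * v)) ≠ 0) → ∃ (q : E) (l : ℝ), q * q = q ∧ q ≠ 0 ∧ l ≠ 0 ∧
        x * q = l • q ∧ q ∈ closedSpan x := by
    intro l hl hlM hne
    refine ⟨_, l, ?_, hne, hl, ?_, ?_⟩
    · simp only [mul_add, add_mul, smul_mul_assoc, mul_smul_comm, hvv, hvx, mul_comm (x * v) v,
        hsq, ← hlM, smul_smul, smul_add]
      match_scalars <;> field_simp <;> ring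
    · simp only [mul_add, mul_smul_comm, hxx, ← hlM, smul_smul, smul_add]
      match_scalars <;> field_simp
    · exact (closedSpan x).smul_mem _ ((closedSpan x).add_mem hvS
        ((closedSpan x).smul_mem _ (mul_mem_closedSpan hvS)))
  by_cases h : (1 / 2 : ℝ) • (v + M⁻¹ • (x * v)) = 0
  · refine main (-M) (neg_ne_zero.mpr hM.ne') (neg_sq M) fun h' => hv0 ?_
    rw [inv_neg] at h'
    linear_combination (norm := module) h + h'
  · exact main M hM.ne' rfl h

theorem mul_eq_of_mem_closedSpan {e x s : E} (he : e * e = e) (hx : e * x = x)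
    (hs : s ∈ closedSpan x) : e * s = s := by
  have h : closedSpan x ≤ LinearMap.ker (LinearMap.mulLeft ℝ e - LinearMap.id) := by
    refine closedSpan_le ?_ fun n => ?_
    · exact isClosed_singleton.preimage (f := fun s : E => e * s - s)
        ((continuous_mul_left e).sub continuous_id)
    · rw [LinearMap.mem_ker, LinearMap.sub_apply, sub_eq_zero]
      change e * _ = _
      induction n with
      | zero => exact hx
      | succ n ih => rw [powSucc_succ, mul_left_comm_of_mul_eq_self he hx, ih]; rfl
  exact sub_eq_zero.mp (h hs)

end Hilbert

/-! ### Finite spectral decomposition into atoms -/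

section Spectral

variable {E : Type*} [EuclideanJordanAlgebra E]

theorem inner_idem_eq_zero {q r : E} (hq : q * q = q) (h : q * r = 0) : inner ℝ q r = 0 := by
  rw [← hq, inner_mul, h, inner_zero_right]

theorem norm_sq_idem_add {q r : E} (hq : q * q = q) (h : q * r = 0) :
    ‖q + r‖ ^ 2 = ‖q‖ ^ 2 + ‖r‖ ^ 2 := by
  rw [norm_add_sq_real, inner_idem_eq_zero hq h]; ring

/-- `‖q‖ = ‖q * q‖ ≤ C ‖q‖²` gives `‖q‖ ≥ 1 / C`. -/
theorem exists_norm_sq_idem_ge (E : Type*) [EuclideanJordanAlgebra E] :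
    ∃ δ : ℝ, 0 < δ ∧ ∀ q : E, q * q = q → q ≠ 0 → δ ≤ ‖q‖ ^ 2 := by
  obtain ⟨C, hC, h⟩ := exists_norm_mul_le E
  refine ⟨C⁻¹ ^ 2, by positivity, fun q hq h0 => ?_⟩
  have h1 := h q q
  have hn : 0 < ‖q‖ := norm_pos_iff.mpr h0
  rw [hq] at h1
  have h2 : 1 ≤ C * ‖q‖ := by
    by_contra! h3
    nlinarith
  have h3 : C⁻¹ ≤ ‖q‖ := (inv_le_iff_one_le_mul₀' hC).mpr h2
  gcongr

theorem inner_mul_self_idem_nonneg {p : E} (hp : p * p = p) (b : E) : 0 ≤ inner ℝ (b * b) p := by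
  rw [inner_mul, mul_comm b p, real_inner_comm]
  exact inner_idem_mul_nonneg hp b

/-- Pairing `e - q` with `1 - e` gives `⟨q, 1 - e⟩ ≤ 0`, so this pairing vanishes and `1 - e`
annihilates `q`. -/
theorem mul_eq_of_idem_le {e q : E} (he : e * e = e) (hq : q * q = q) (h : Le q e) :
    e * q = q := by
  have hf := isIdempotentElem_one_sub he
  obtain ⟨b, hb⟩ := h
  have h1 := inner_mul_self_idem_nonneg hf b
  have h2 := inner_mul_self_idem_nonneg hf q
  have h3 : inner ℝ e (1 - e) = 0 := inner_idem_eq_zero he (by rw [mul_sub, mul_one, he, sub_self])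
  rw [← hb, inner_sub_left, h3] at h1
  have h4 : inner ℝ (q * q) (1 - e) = 0 := by
    rw [hq] at h2 ⊢
    linarith
  rw [inner_mul, mul_comm q, real_inner_comm] at h4
  have h5 := idem_mul_eq_zero_of_inner hf h4
  rw [sub_mul, one_mul, sub_eq_zero] at h5
  exact h5.symm

theorem sum_smul_mul_sum_smul {ι : Type*} [Fintype ι] {p : ι → E}
    (hp : ∀ i, p i * p i = p i) (ho : ∀ i j, i ≠ j → p i * p j = 0) (l k : ι → ℝ) :
    (∑ i, l i • p i) * (∑ i, k i • p i) = ∑ i, (l i * k i) • p i := by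
  rw [Finset.sum_mul]
  refine Finset.sum_congr rfl fun i _ => ?_
  rw [Finset.mul_sum, Finset.sum_eq_single i]
  · rw [smul_mul_smul_comm, hp]
  · intro j _ hj
    rw [smul_mul_smul_comm, ho i j hj.symm, smul_zero]
  · simp

theorem sum_smul_mul_apply {ι : Type*} [Fintype ι] {p : ι → E}
    (hp : ∀ i, p i * p i = p i) (ho : ∀ i j, i ≠ j → p i * p j = 0) (l : ι → ℝ) (j : ι) :
    (∑ i, l i • p i) * p j = l j • p j := by
  rw [Finset.sum_mul, Finset.sum_eq_single j]
  · rw [smul_mul_assoc, hp]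
  · intro i _ hi
    rw [smul_mul_assoc, ho i j hi, smul_zero]
  · simp

theorem sum_mul_apply {ι : Type*} [Fintype ι] {p : ι → E}
    (hp : ∀ i, p i * p i = p i) (ho : ∀ i j, i ≠ j → p i * p j = 0) (j : ι) :
    (∑ i, p i) * p j = p j := by
  simpa using sum_smul_mul_apply hp ho 1 j

theorem inner_sum_smul {ι : Type*} [Fintype ι] {p : ι → E}
    (hp : ∀ i, p i * p i = p i) (ho : ∀ i j, i ≠ j → p i * p j = 0) (l : ι → ℝ) (j : ι) :
    inner ℝ (∑ i, l i • p i) (p j) = l j * ‖p j‖ ^ 2 := by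
  have h : inner ℝ (∑ i, l i • p i) (p j) = inner ℝ ((∑ i, l i • p i) * p j) (p j) := by
    rw [mul_comm, inner_mul, real_inner_comm, real_inner_comm _ (∑ i, l i • p i), hp]
  rw [h, sum_smul_mul_apply hp ho, inner_smul_left, real_inner_self_eq_norm_sq]
  rfl

/-- `x` is a finite linear combination of orthogonal atomic idempotents with sum `e`. -/
def HasSpectralDecomposition (e x : E) : Prop :=
  ∃ (ι : Type) (_ : Fintype ι) (l : ι → ℝ) (p : ι → E), (∀ i, IsAtomicIdem (p i)) ∧
    (∀ i j, i ≠ j → p i * p j = 0) ∧ e = ∑ i, p i ∧ x = ∑ i, l i • p i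

theorem HasSpectralDecomposition.add {q r x y : E} (hq : q * q = q) (hr : r * r = r)
    (hqr : q * r = 0) (hx : HasSpectralDecomposition q x) (hy : HasSpectralDecomposition r y) :
    HasSpectralDecomposition (q + r) (x + y) := by
  obtain ⟨ι, _, l, p, hp, ho, hs, rfl⟩ := hx
  obtain ⟨κ, _, k, t, ht, ho', hs', rfl⟩ := hy
  have h1 : ∀ i j, p i * t j = 0 := by
    intro i j
    have hpi : q * p i = p i := by rw [hs]; exact sum_mul_apply (fun i => (hp i).1) ho i
    have htj : r * t j = t j := by rw [hs']; exact sum_mul_apply (fun i => (ht i).1) ho' j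
    refine mul_eq_zero_of_peirce hq hpi ?_
    rw [mul_comm]
    exact mul_eq_zero_of_peirce hr htj (by rw [mul_comm, hqr])
  refine ⟨ι ⊕ κ, inferInstance, Sum.elim l k, Sum.elim p t, ?_, ?_, ?_, ?_⟩
  · rintro (i | j)
    exacts [hp i, ht j]
  · rintro (i | i) (j | j) hij
    · exact ho i j fun h => hij (by rw [h])
    · exact h1 i j
    · exact (mul_comm _ _).trans (h1 j i)
    · exact ho' i j fun h => hij (by rw [h])
  · simp [hs, hs']
  · simp

theorem exists_splitting_idem {e x : E} (he : e * e = e) (he0 : e ≠ 0) (hx : e * x = x)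
    (h : ¬ (IsAtomicIdem e ∧ ∃ m : ℝ, x = m • e)) :
    ∃ (q : E) (l : ℝ), q * q = q ∧ q ≠ 0 ∧ q ≠ e ∧ e * q = q ∧ x * q = l • q := by
  by_cases hm : ∃ m : ℝ, x = m • e
  · have hna : ¬ IsAtomicIdem e := fun h' => h ⟨h', hm⟩
    obtain ⟨m, rfl⟩ := hm
    unfold IsAtomicIdem at hna
    push Not at hna
    obtain ⟨q, hq, hq0, hle, hne⟩ := hna he he0
    have heq := mul_eq_of_idem_le he hq hle
    exact ⟨q, m, hq, hq0, hne, heq, by rw [smul_mul_assoc, heq]⟩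
  · have hx0 : x ≠ 0 := fun h0 => hm ⟨0, by rw [h0, zero_smul]⟩
    obtain ⟨q, l, hq, hq0, -, hxq, hmem⟩ := exists_eigen_idem hx0
    refine ⟨q, l, hq, hq0, ?_, mul_eq_of_mem_closedSpan he hx hmem, hxq⟩
    rintro rfl
    exact hm ⟨l, by rw [← hxq, mul_comm, hx]⟩

theorem idem_sub {e q : E} (he : e * e = e) (hq : q * q = q) (heq : e * q = q) :
    (e - q) * (e - q) = e - q := by
  rw [sub_mul, mul_sub, mul_sub, he, hq, heq, mul_comm q e, heq]; abel

/-- Induction on how many times `δ` fits into `‖e‖²`: by Pythagoras, splitting `e` into `q` and `e -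
q` leaves each part at least `δ` smaller in squared norm. -/
theorem hasSpectralDecomposition_of_norm_le {δ : ℝ}
    (hδ : ∀ q : E, q * q = q → q ≠ 0 → δ ≤ ‖q‖ ^ 2) (n : ℕ) :
    ∀ e x : E, e * e = e → ‖e‖ ^ 2 ≤ n * δ → e * x = x → HasSpectralDecomposition e x := by
  have hzero : ∀ x : E, (0 : E) * x = x → HasSpectralDecomposition 0 x := by
    intro x hx
    rw [zero_mul] at hx
    exact ⟨Empty, inferInstance, Empty.elim, Empty.elim, fun i => i.elim, fun i => i.elim,
      by simp, by simp [← hx]⟩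
  induction n with
  | zero =>
    intro e x he hn hx
    have h0 : e = 0 := by
      rw [Nat.cast_zero, zero_mul] at hn
      exact norm_eq_zero.mp (pow_eq_zero_iff two_ne_zero |>.mp (le_antisymm hn (sq_nonneg _)))
    subst h0
    exact hzero x hx
  | succ n ih =>
    intro e x he hn hx
    by_cases he0 : e = 0
    · subst he0
      exact hzero x hx
    by_cases h : IsAtomicIdem e ∧ ∃ m : ℝ, x = m • e
    · obtain ⟨ha, m, rfl⟩ := h
      exact ⟨Unit, inferInstance, fun _ => m, fun _ => e, fun _ => ha,
        fun i j hij => (hij rfl).elim, by simp, by simp⟩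
    · obtain ⟨q, l, hq, hq0, hqe, heq, hxq⟩ := exists_splitting_idem he he0 hx h
      have hr := idem_sub he hq heq
      have hqr : q * (e - q) = 0 := by rw [mul_sub, hq, mul_comm, heq, sub_self]
      have hsum := norm_sq_idem_add hq hqr
      rw [add_sub_cancel] at hsum
      have hq1 := hδ q hq hq0
      have hr1 := hδ (e - q) hr (sub_ne_zero.mpr hqe.symm)
      push_cast at hn
      have d1 := ih q (l • q) hq (by linarith) (by rw [mul_smul_comm, hq])
      have d2 := ih (e - q) (x - l • q) hr (by linarith) (by
        rw [sub_mul, mul_sub, mul_sub, hx, mul_smul_comm, heq, mul_comm q x, hxq, mul_smul_comm,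
          hq]
        abel)
      have := d1.add hq hr hqr d2
      rwa [add_sub_cancel, add_sub_cancel] at this

/-- The spectral theorem: every element is a finite linear combination of orthogonal atomic
idempotents with sum `1`. -/
theorem hasSpectralDecomposition_one (x : E) : HasSpectralDecomposition 1 x := by
  obtain ⟨δ, hδ0, hδ⟩ := exists_norm_sq_idem_ge E
  obtain ⟨n, hn⟩ := exists_nat_ge (‖(1 : E)‖ ^ 2 / δ)
  exact hasSpectralDecomposition_of_norm_le hδ n 1 x (mul_one 1) ((div_le_iff₀ hδ0).mp hn)
    (one_mul x)

/-- Otherwise `x` would split off a non-zero idempotent strictly below the atom. -/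
theorem exists_eq_smul_of_isAtomicIdem {p x : E} (hp : IsAtomicIdem p) (hx : p * x = x) :
    ∃ m : ℝ, x = m • p := by
  by_contra hm
  obtain ⟨q, l, hq, hq0, hqp, hpq, -⟩ :=
    exists_splitting_idem hp.1 hp.2.1 hx fun h => hm h.2
  exact hqp (hp.2.2 q hq hq0 ⟨p - q, (idem_sub hp.1 hq hpq).symm⟩)

end Spectral

/-! ### Self-dual cone, positivity of `Q`, ceilings and images -/

section Cone

variable {E : Type*} [EuclideanJordanAlgebra E]

theorem isPos_idem {p : E} (hp : p * p = p) : IsPos p := ⟨p, hp.symm⟩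

theorem IsPos.exists_spectral {x : E} (hx : IsPos x) :
    ∃ (ι : Type) (_ : Fintype ι) (l : ι → ℝ) (p : ι → E), (∀ i, IsAtomicIdem (p i)) ∧
      (∀ i j, i ≠ j → p i * p j = 0) ∧ 1 = ∑ i, p i ∧ (∀ i, 0 ≤ l i) ∧ x = ∑ i, l i • p i := by
  obtain ⟨b, rfl⟩ := hx
  obtain ⟨ι, _, l, p, hp, ho, h1, rfl⟩ := hasSpectralDecomposition_one b
  exact ⟨ι, _, fun i => l i * l i, p, hp, ho, h1, fun i => mul_self_nonneg _,
    sum_smul_mul_sum_smul (fun i => (hp i).1) ho l l⟩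

/-- The cone of squares is contained in its dual. -/
theorem IsPos.inner_nonneg {x y : E} (hx : IsPos x) (hy : IsPos y) : 0 ≤ inner ℝ x y := by
  obtain ⟨b, rfl⟩ := hx
  obtain ⟨ι, _, l, p, hp, -, -, hl, rfl⟩ := hy.exists_spectral
  rw [inner_sum]
  refine Finset.sum_nonneg fun i _ => ?_
  rw [inner_smul_right]
  exact mul_nonneg (hl i) (inner_mul_self_idem_nonneg (hp i).1 b)

/-- The cone of squares contains its dual. -/
theorem isPos_of_inner_nonneg {x : E} (h : ∀ p : E, IsPos p → 0 ≤ inner ℝ x p) : IsPos x := by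
  obtain ⟨ι, _, l, p, hp, ho, h1, rfl⟩ := hasSpectralDecomposition_one x
  have hl : ∀ i, 0 ≤ l i := fun i => by
    have h2 := h (p i) (isPos_idem (hp i).1)
    rw [inner_sum_smul (fun i => (hp i).1) ho] at h2
    exact nonneg_of_mul_nonneg_left h2 (by have := norm_pos_iff.mpr (hp i).2.1; positivity)
  refine ⟨∑ i, √(l i) • p i, ?_⟩
  rw [sum_smul_mul_sum_smul (fun i => (hp i).1) ho]
  exact Finset.sum_congr rfl fun i _ => by rw [Real.mul_self_sqrt (hl i)]

theorem isPos_sum_smul {ι : Type*} [Fintype ι] {l : ι → ℝ} {x : ι → E} (hl : ∀ i, 0 ≤ l i)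
    (hx : ∀ i, IsPos (x i)) : IsPos (∑ i, l i • x i) := by
  refine isPos_of_inner_nonneg fun p hp => ?_
  rw [sum_inner]
  refine Finset.sum_nonneg fun i _ => ?_
  rw [inner_smul_left]
  exact mul_nonneg (hl i) ((hx i).inner_nonneg hp)

theorem IsPos.smul {x : E} (hx : IsPos x) {c : ℝ} (hc : 0 ≤ c) : IsPos (c • x) := by
  obtain ⟨b, rfl⟩ := hx
  exact ⟨√c • b, by rw [smul_mul_smul_comm, Real.mul_self_sqrt hc]⟩

theorem IsPos.eq_zero_of_inner_one {x : E} (hx : IsPos x) (h : inner ℝ x 1 = 0) : x = 0 := by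
  obtain ⟨b, rfl⟩ := hx
  rw [inner_self_eq] at h
  rw [inner_self_eq_zero.mp h, mul_zero]

/-- `Q p a²` lies in the Peirce 1-space of the atom, so it is `c • p`, and `(Q a p)² = c • Q a p`.
Pairing with `p` shows `c ≥ 0`: if `c > 0`, `Q a p` is a scaled square; if `c = 0`, it vanishes. -/
theorem isPos_Q_atom (a : E) {p : E} (hp : IsAtomicIdem p) : IsPos (Q a p) := by
  have hpp : p * p = p := hp.1
  have hQp : Q p p = p := by rw [Q_apply, hpp, hpp]; module
  obtain ⟨c, hc⟩ := exists_eq_smul_of_isAtomicIdem hp (idem_mul_Q hpp (a * a))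
  have hn : 0 < ‖p‖ ^ 2 := by have := norm_pos_iff.mpr hp.2.1; positivity
  have hc0 : 0 ≤ c := by
    have h1 : inner ℝ (Q p (a * a)) p = c * ‖p‖ ^ 2 := by
      rw [hc, inner_smul_left, real_inner_self_eq_norm_sq]; rfl
    rw [Q_isSymmetric, hQp] at h1
    exact nonneg_of_mul_nonneg_left (h1 ▸ inner_mul_self_idem_nonneg hpp a) hn
  have hsq : Q a p * Q a p = c • Q a p := by rw [Q_apply_mul_Q_apply, hc, map_smul]
  rcases hc0.eq_or_lt with rfl | hc0
  · rw [zero_smul] at hsq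
    have h2 := inner_self_eq (Q a p)
    rw [hsq, inner_zero_left] at h2
    rw [inner_self_eq_zero.mp h2.symm]
    exact ⟨0, (mul_zero 0).symm⟩
  · have : Q a p = c⁻¹ • (Q a p * Q a p) := by
      rw [hsq, smul_smul, inv_mul_cancel₀ hc0.ne', one_smul]
    rw [this]
    exact IsPos.smul ⟨_, rfl⟩ (inv_nonneg.mpr hc0.le)

/-- The quadratic representation preserves positivity. -/
theorem isPositiveMap_Q (a : E) : IsPositiveMap (Q a) := by
  intro x hx
  obtain ⟨ι, _, l, p, hp, -, -, hl, rfl⟩ := hx.exists_spectral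
  rw [map_sum]
  simp only [map_smul]
  exact isPos_sum_smul hl fun i => isPos_Q_atom a (hp i)

theorem IsPos.exists_isCeil {x : E} (hx : IsPos x) : ∃ c : E, IsCeil x c := by
  classical
  obtain ⟨ι, _, l, p, hp, ho, -, hl, rfl⟩ := hx.exists_spectral
  let e := Fintype.equivFin {i // l i ≠ 0}
  refine ⟨_, _, fun j => l (e.symm j), fun j => p (e.symm j),
    fun j => (hl _).lt_of_ne' (e.symm j).2, fun j => hp _, fun i j hij => ho _ _ fun h => hij ?_,
    ?_, rfl⟩
  · exact e.symm.injective (Subtype.ext h)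
  · rw [e.symm.sum_comp fun i : {i // l i ≠ 0} => l i • p i,
      ← Finset.sum_subtype (Finset.univ.filter fun i => l i ≠ 0) (by simp) fun i => l i • p i]
    have hne : ∀ i ∈ Finset.univ, l i • p i ≠ 0 → l i ≠ 0 := fun i _ h h0 =>
      h (by rw [h0, zero_smul])
    exact (Finset.sum_filter_of_ne hne).symm

theorem IsCeil.idem {x c : E} (h : IsCeil x c) : c * c = c := by
  obtain ⟨n, l, p, -, hp, ho, -, rfl⟩ := h
  simpa using sum_smul_mul_sum_smul (fun i => (hp i).1) ho 1 1

theorem IsCeil.inner_eq_zero_iff {x c s : E} (h : IsCeil x c) (hs : IsPos s) :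
    inner ℝ s x = 0 ↔ inner ℝ s c = 0 := by
  obtain ⟨n, l, p, hl, hp, -, rfl, rfl⟩ := h
  have h0 : ∀ i, 0 ≤ inner ℝ s (p i) := fun i => hs.inner_nonneg (isPos_idem (hp i).1)
  simp only [inner_sum, inner_smul_right]
  rw [Finset.sum_eq_zero_iff_of_nonneg fun i _ => mul_nonneg (hl i).le (h0 i),
    Finset.sum_eq_zero_iff_of_nonneg fun i _ => h0 i]
  simp [(hl _).ne']

/-- Writing `1 - r = b²`, the hypothesis gives `c * b = 0`, hence `c * r = c`, and then `r - c = Q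
(1 - c) r` is positive. -/
theorem IsEffect.le_of_inner_eq_zero {c r : E} (hc : c * c = c) (hr : IsEffect r)
    (h : inner ℝ (1 - r) c = 0) : Le c r := by
  obtain ⟨hr0, b, hb⟩ := hr
  rw [hb, inner_mul, mul_comm b c, real_inner_comm] at h
  have hcb := idem_mul_eq_zero_of_inner hc h
  have hcs : c * (1 - r) = 0 := by rw [hb, mul_left_comm_of_mul_eq_zero hc hcb, hcb, mul_zero]
  have hcr : c * r = c := by
    rw [mul_sub, mul_one, sub_eq_zero] at hcs
    exact hcs.symm
  have h1 := isPositiveMap_Q (1 - c) r hr0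
  have h2 : Q (1 - c) r = r - c := by
    have h3 : (1 - c) * r = r - c := by rw [sub_mul, one_mul, hcr]
    have h4 : (1 - c) * (r - c) = r - c := by
      rw [sub_mul, one_mul, mul_sub, hcr, hc, sub_self, sub_zero]
    rw [Q_apply, isIdempotentElem_one_sub hc, h3, h4]
    module
  rwa [h2] at h1

theorem isEffect_idem {c : E} (hc : c * c = c) : IsEffect c :=
  ⟨isPos_idem hc, isPos_idem (isIdempotentElem_one_sub hc)⟩

theorem IsCeil.isImage {f : E →ₗ[ℝ] E} (hf : IsPositiveMap f) (hs : f.IsSymmetric) {p c : E}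
    (hp : p * p = p) (hc : IsCeil (f p) c) : IsImage (Q p ∘ₗ f) c := by
  -- A positive element vanishes once its pairing with `1` does; symmetry of `Q p` and `f` moves
  -- that pairing onto `f p`, then onto its ceiling.
  have key : ∀ r : E, IsEffect r → ((Q p ∘ₗ f) r = (Q p ∘ₗ f) 1 ↔ inner ℝ (1 - r) c = 0) := by
    intro r hr
    have hpos : IsPos ((Q p ∘ₗ f) (1 - r)) := isPositiveMap_Q p _ (hf _ hr.2)
    have hin : inner ℝ ((Q p ∘ₗ f) (1 - r)) 1 = inner ℝ (1 - r) (f p) := by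
      rw [LinearMap.comp_apply, Q_isSymmetric, Q_one_right, hp, hs]
    rw [← hc.inner_eq_zero_iff hr.2, ← hin]
    refine ⟨fun h => ?_, fun h => ?_⟩
    · rw [map_sub, h, sub_self, inner_zero_left]
    · have h0 := hpos.eq_zero_of_inner_one h
      rw [map_sub, sub_eq_zero] at h0
      exact h0.symm
  have hcc := hc.idem
  refine ⟨isEffect_idem hcc, (key c (isEffect_idem hcc)).mpr ?_, fun r hr h =>
    hr.le_of_inner_eq_zero hcc ((key r hr).mp h)⟩
  exact inner_idem_eq_zero (isIdempotentElem_one_sub hcc)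
    (by rw [sub_mul, one_mul, hcc, sub_self])

theorem isDiamondSelfAdjoint_of_isSymmetric {f : E →ₗ[ℝ] E} (hf : IsPositiveMap f)
    (hs : f.IsSymmetric) : IsDiamondSelfAdjoint f := by
  have h : ∀ p : Idem E, ∃ c : Idem E, IsCeil (f p.1) c.1 := fun p => by
    obtain ⟨c, hc⟩ := (hf p.1 (isPos_idem p.2)).exists_isCeil
    exact ⟨⟨c, hc.idem⟩, hc⟩
  choose φ hφ using h
  exact ⟨hf, hf, φ, hφ, fun p => (hφ p).isImage hf hs p.2⟩

theorem isDiamondSelfAdjoint_Q (a : E) : IsDiamondSelfAdjoint (Q a) :=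
  isDiamondSelfAdjoint_of_isSymmetric (isPositiveMap_Q a) (Q_isSymmetric a)

theorem IsPos.le_one_of_mul_self_le_one {a : E} (ha : IsPos a) (h : Le (a * a) 1) : Le a 1 := by
  obtain ⟨ι, _, l, p, hp, ho, h1, hl, rfl⟩ := ha.exists_spectral
  have hpp : ∀ i, p i * p i = p i := fun i => (hp i).1
  have hle : ∀ i, l i ≤ 1 := fun i => by
    have h2 := IsPos.inner_nonneg h (isPos_idem (hpp i))
    have h3 : 1 - (∑ i, l i • p i) * (∑ i, l i • p i) = ∑ i, (1 - l i * l i) • p i := by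
      rw [sum_smul_mul_sum_smul hpp ho, h1, ← Finset.sum_sub_distrib]
      exact Finset.sum_congr rfl fun i _ => by module
    rw [h3, inner_sum_smul hpp ho] at h2
    have h4 : 0 ≤ 1 - l i * l i :=
      nonneg_of_mul_nonneg_left h2 (by have := norm_pos_iff.mpr (hp i).2.1; positivity)
    nlinarith [hl i]
  have h5 : 1 - ∑ i, l i • p i = ∑ i, (1 - l i) • p i := by
    rw [h1, ← Finset.sum_sub_distrib]
    exact Finset.sum_congr rfl fun i _ => by module
  unfold Le
  rw [h5]
  exact isPos_sum_smul (fun i => sub_nonneg.mpr (hle i)) fun i => isPos_idem (hpp i)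

end Cone

end EuclideanJordanAlgebra

theorem mainTheorem12 {E : Type*} [EuclideanJordanAlgebra E] :
    (∀ f : E →ₗ[ℝ] E, EuclideanJordanAlgebra.IsPositiveMap f → f.IsSymmetric →
      EuclideanJordanAlgebra.IsDiamondSelfAdjoint f) ∧
    (∀ a : E, EuclideanJordanAlgebra.IsDiamondSelfAdjoint (EuclideanJordanAlgebra.Q a)) ∧
    (∀ a : E, EuclideanJordanAlgebra.IsPos a →
      EuclideanJordanAlgebra.IsDiamondPositive (EuclideanJordanAlgebra.Q a)) ∧
    (∀ a : E, EuclideanJordanAlgebra.IsPos a →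
      EuclideanJordanAlgebra.IsSubunital (EuclideanJordanAlgebra.Q a) →
      EuclideanJordanAlgebra.IsSubunitalDiamondPositive (EuclideanJordanAlgebra.Q a)) := by
  refine ⟨fun f hf hs => EuclideanJordanAlgebra.isDiamondSelfAdjoint_of_isSymmetric hf hs,
    fun a => EuclideanJordanAlgebra.isDiamondSelfAdjoint_Q a, ?_, ?_⟩
  · rintro _ ⟨b, rfl⟩
    exact ⟨EuclideanJordanAlgebra.Q b, EuclideanJordanAlgebra.isDiamondSelfAdjoint_Q b,
      (EuclideanJordanAlgebra.Q_comp_Q_self b).symm⟩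
  · intro a ha hsub
    obtain ⟨b, hb⟩ := id ha
    refine ⟨hsub, EuclideanJordanAlgebra.Q b, ?_,
      EuclideanJordanAlgebra.isDiamondSelfAdjoint_Q b, ?_⟩
    -- Since `Q a 1 = a²` and `Q b 1 = b² = a`, the claim is that `a² ≤ 1` implies `a ≤ 1` for
    -- positive `a`.
    · unfold EuclideanJordanAlgebra.IsSubunital at hsub ⊢
      rw [EuclideanJordanAlgebra.Q_one_right] at hsub ⊢
      rw [← hb]
      exact ha.le_one_of_mul_self_le_one hsub
    · rw [EuclideanJordanAlgebra.Q_comp_Q_self, hb]
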